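/- Let $n,k,l\ge 1$ be integers and let $A_{k,l}=(-\Delta)^l+|x|^{2k}+1$ be the anharmonic oscillator on $\mathbb{R}^n$. Let $(u_j)_{j\in\mathbb{N}}$ be an orthonormal basis of $L^2(\mathbb{R}^n)$ consisting of eigenfunctions of $A_{k,l}$, that is, $A_{k,l}u_j=\lambda_j u_j$ with $\lambda_j\in\mathbb{R}$ (in the sense of tempered distributions). Define the $A_{k,l}$-Fourier transform by $$(\mathcal{F}_{A_{k,l}}f)(j)=\int_{\mathbb{R}^n} f(x)\,\overline{u_j(x)}\,dx,\qquad j\in\mathbb{N}.$$ Let $1<p\le 2$ and let $\varphi:\mathbb{N}\to(0,\infty)$ be a sequence such that $$M_\varphi:=\sup_{t>0}\; t\sum_{j\in\mathbb{N}:\ \varphi(j)\ge t}\|u_j\|_{L^\infty(\mathbb{R}^n)}^2<\infty .$$ Then for every $f\in L^p(\mathbb{R}^n)$ the integrals defining $(\mathcal{F}_{A_{k,l}}f)(j)$ converge absolutely and $$\Big(\sum_{j\in\mathbb{N}}|(\mathcal{F}_{A_{k,l}}f)(j)|^p\,\|u_j\|_{L^\infty(\mathbb{R}^n)}^{2-p}\,\varphi(j)^{2-p}\Big)^{1/p}\le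 C_p\,M_\varphi^{\frac{2-p}{p}}\,\|f\|_{L^p(\mathbb{R}^n)},$$ where the constant $C_p$ depends only on $p$. -/

import Mathlib

open MeasureTheory Laplacian
open scoped ENNReal NNReal SchwartzMap ComplexConjugate

namespace Anharmonic

noncomputable section

/-- The potential `x ↦ |x|^{2k} + 1` on `ℝⁿ` (Euclidean norm), as a complex-valued function. -/
def potential (n k : ℕ) (x : EuclideanSpace ℝ (Fin n)) : ℂ :=
  ((‖x‖ ^ (2 * k) + 1 : ℝ) : ℂ)

/-- The potential has temperate growth, so multiplication by it is the genuine multiplication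
operator on tempered distributions (and not the default value of `smulLeftCLM`). -/
theorem potential_hasTemperateGrowth (n k : ℕ) : (potential n k).HasTemperateGrowth := by
  have h := ((Function.hasTemperateGrowth_norm_sq
    (H := EuclideanSpace ℝ (Fin n))).pow k).add (Function.HasTemperateGrowth.const (1 : ℝ))
  have h2 := Function.HasTemperateGrowth.comp Function.Complex.hasTemperateGrowth_ofReal h
  have e : potential n k = Complex.ofReal ∘
      ((fun x : EuclideanSpace ℝ (Fin n) => ‖x‖ ^ 2) ^ k + fun _ => (1 : ℝ)) := by
    funext x
    simp [potential, pow_mul]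
  rw [e]
  exact h2

/-- The anharmonic oscillator `A_{k,l} = (-Δ)^l + |x|^{2k} + 1` on `ℝⁿ`, acting on tempered
distributions. -/
def oscillator (n k l : ℕ) (T : 𝓢'(EuclideanSpace ℝ (Fin n), ℂ)) :
    𝓢'(EuclideanSpace ℝ (Fin n), ℂ) :=
  (fun S : 𝓢'(EuclideanSpace ℝ (Fin n), ℂ) => -Δ S)^[l] T +
    TemperedDistribution.smulLeftCLM ℂ (potential n k) T

/-- The orthonormal basis `(u_j)` of `L²(ℝⁿ)` consists of eigenfunctions of `A_{k,l}`:
`A_{k,l} u_j = λ_j u_j` for real numbers `λ_j`. Since `A_{k,l} u_j` is then in `L²`, each `u_j` lies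
in the `L²`-domain of `A_{k,l}`. -/
def IsEigenbasis (n k l : ℕ) (lam : ℕ → ℝ)
    (u : HilbertBasis ℕ ℂ (Lp ℂ 2 (volume : Measure (EuclideanSpace ℝ (Fin n))))) : Prop :=
  ∀ j, oscillator n k l (Lp.toTemperedDistribution (u j)) =
    (lam j : ℂ) • Lp.toTemperedDistribution (u j)

/-- The `A_{k,l}`-Fourier transform `(F f)(j) = ∫ f(x) conj(u_j(x)) dx`. -/
def fourier {n : ℕ}
    (u : HilbertBasis ℕ ℂ (Lp ℂ 2 (volume : Measure (EuclideanSpace ℝ (Fin n)))))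
    (f : EuclideanSpace ℝ (Fin n) → ℂ) (j : ℕ) : ℂ :=
  ∫ x, f x * conj (u j x)

/-- The (possibly infinite) norm `‖u_j‖_{L^∞(ℝⁿ)}`. -/
def supNorm {n : ℕ}
    (u : HilbertBasis ℕ ℂ (Lp ℂ 2 (volume : Measure (EuclideanSpace ℝ (Fin n))))) (j : ℕ) : ℝ≥0∞ :=
  eLpNorm (u j) ∞ volume

/-- `M_φ = sup_{t > 0} t ∑_{j : φ(j) ≥ t} ‖u_j‖_∞²`, in `[0, ∞]`. -/
def paleyConst {n : ℕ}
    (u : HilbertBasis ℕ ℂ (Lp ℂ 2 (volume : Measure (EuclideanSpace ℝ (Fin n)))))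
    (φ : ℕ → ℝ) : ℝ≥0∞ :=
  ⨆ (t : ℝ) (_ : 0 < t), ENNReal.ofReal t * ∑' j : {j : ℕ // t ≤ φ j}, supNorm u j ^ 2

end

end Anharmonic

namespace Anharmonic

/-! Write `b j` for the sup norm of `u j` and `M` for the Paley constant. Give the index `j` the
mass `(b j * φ j) ^ 2` and consider the normalized coefficients `|f̂(j)| / (b j * φ j)`. The `p`-th
power of their weighted `ℓ^p` norm is exactly the sum to be bounded.

For `p < 2` this is Marcinkiewicz interpolation. Bessel's inequality gives the bound from `L²` to
weighted `ℓ²`. For integrable `f`, `|f̂(j)| ≤ b j * ‖f‖₁`, so a normalized coefficient exceeds `t`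
only where `φ j < ‖f‖₁ / t`. By the layer-cake formula this set has mass at most `2 * M * ‖f‖₁ / t`
(`setLIntegral_sq_lt_le`), a weak (1,1) bound linear in `M`.

Cutting `f` at height `M * t` combines the two bounds (`distribution_coefficients_le`). Integrating
in `t` then gives the factor `M ^ (2 - p)` (`lintegral_rpow_le_of_distribution_le`). At `p = 2` all
weights disappear and Bessel suffices. -/

/-! ### Real-variable interpolation and layer-cake estimates. -/

theorem lintegral_Ioi_indicator_lt_rpow {q s : ℝ} (hq : 0 < q) (hs : 0 ≤ s) :
    ∫⁻ t in Set.Ioi (0 : ℝ), (Set.Iio s).indicator (fun t => ENNReal.ofReal (t ^ (q - 1))) t =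
      ENNReal.ofReal (s ^ q / q) := by
  have hint : IntegrableOn (fun t : ℝ => t ^ (q - 1)) (Set.Ioc 0 s) := by
    rw [← intervalIntegrable_iff_integrableOn_Ioc_of_le hs]
    exact intervalIntegral.intervalIntegrable_rpow' (by linarith)
  rw [lintegral_indicator measurableSet_Iio, Measure.restrict_restrict measurableSet_Iio,
    Set.inter_comm, Set.Ioi_inter_Iio, setLIntegral_congr Ioo_ae_eq_Ioc,
    ← ofReal_integral_eq_lintegral_ofReal hint, ← intervalIntegral.integral_of_le hs,
    integral_rpow (Or.inl (by linarith))]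
  · simp [Real.zero_rpow hq.ne']
  · filter_upwards [ae_restrict_mem measurableSet_Ioc] with t ht
    exact Real.rpow_nonneg ht.1.le _

theorem lintegral_Ioi_indicator_ge_rpow {q s : ℝ} (hq : q < 0) (hs : 0 < s) :
    ∫⁻ t in Set.Ioi (0 : ℝ), (Set.Ici s).indicator (fun t => ENNReal.ofReal (t ^ (q - 1))) t =
      ENNReal.ofReal (s ^ q / (-q)) := by
  have hint := integrableOn_Ioi_rpow_of_lt (a := q - 1) (by linarith) hs
  rw [lintegral_indicator measurableSet_Ici, Measure.restrict_restrict measurableSet_Ici,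
    Set.inter_eq_left.2 (Set.Ici_subset_Ioi.2 hs),
    setLIntegral_congr Ioi_ae_eq_Ici.symm,
    ← ofReal_integral_eq_lintegral_ofReal hint, integral_Ioi_rpow_of_lt (by linarith) hs]
  · rw [sub_add_cancel, div_neg, neg_div]
  · filter_upwards [ae_restrict_mem measurableSet_Ioi] with t ht
    exact Real.rpow_nonneg (hs.trans ht).le _

/-- The real-variable core of Marcinkiewicz interpolation between a weak `(1,1)` bound with
constant `M` and a `(2,2)` bound: if the distribution function of `g` at height `t` is controlled
by the `L¹` norm of the part of `F` above `M t` and the `L²` norm of the part below, then the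
`L^p` norm of `g` is controlled by that of `F`. -/
theorem lintegral_rpow_le_of_distribution_le {X Y : Type*} [MeasurableSpace X] [MeasurableSpace Y]
    {μ : Measure X} [SFinite μ] {ν : Measure Y} {p M : ℝ} (hp1 : 1 < p) (hp2 : p < 2) (hM : 0 < M)
    {F : X → ℝ} (hF : Measurable F) (hF0 : ∀ x, 0 ≤ F x)
    {g : Y → ℝ} (hg : Measurable g) (hg0 : ∀ y, 0 ≤ g y)
    (h : ∀ t : ℝ, 0 < t → ν {y | t < g y} ≤
      ∫⁻ x, (if M * t < F x then ENNReal.ofReal (4 * M / t * F x)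
        else ENNReal.ofReal (4 / t ^ 2 * F x ^ 2)) ∂μ) :
    ∫⁻ y, ENNReal.ofReal (g y ^ p) ∂ν ≤
      ENNReal.ofReal (p * (4 / (p - 1) + 4 / (2 - p)) * M ^ (2 - p)) *
        ∫⁻ x, ENNReal.ofReal (F x ^ p) ∂μ := by
  set W : ℝ → X → ℝ≥0∞ := fun t x => (if M * t < F x then ENNReal.ofReal (4 * M / t * F x)
        else ENNReal.ofReal (4 / t ^ 2 * F x ^ 2)) with hW
  have hWm : Measurable (Function.uncurry W) := by
    refine Measurable.ite (measurableSet_lt (by fun_prop) (by fun_prop)) ?_ ?_ <;> fun_prop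
  have hinner : ∀ x, ∫⁻ t in Set.Ioi (0 : ℝ), W t x * ENNReal.ofReal (t ^ (p - 1)) ≤
      ENNReal.ofReal ((4 / (p - 1) + 4 / (2 - p)) * M ^ (2 - p)) * ENNReal.ofReal (F x ^ p) := by
    intro x
    rcases (hF0 x).eq_or_lt with h0 | h0
    -- The zero value is set apart because `t ^ (p - 3)` is not integrable at `0`; here its
    -- coefficient vanishes.
    · have : ∀ t, W t x = 0 := fun t => by simp [hW, ← h0]
      simp [this]
    have hs : 0 < F x / M := by positivity
    -- For fixed `x` the cut happens at `t = F x / M`: below it the integrand is a multiple of `t ^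
    -- (p - 2)`, above it of `t ^ (p - 3)`. These converge at `0` and at `∞` because `1 < p < 2`.
    calc ∫⁻ t in Set.Ioi (0 : ℝ), W t x * ENNReal.ofReal (t ^ (p - 1))
        = ∫⁻ t in Set.Ioi (0 : ℝ), (ENNReal.ofReal (4 * M * F x) * (Set.Iio (F x / M)).indicator
            (fun t => ENNReal.ofReal (t ^ (p - 1 - 1))) t +
          ENNReal.ofReal (4 * F x ^ 2) * (Set.Ici (F x / M)).indicator
            (fun t => ENNReal.ofReal (t ^ (p - 2 - 1))) t) := by
          refine setLIntegral_congr_fun measurableSet_Ioi fun t (ht : 0 < t) => ?_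
          by_cases hc : t < F x / M
          · have hc' : M * t < F x := by rwa [lt_div_iff₀' hM] at hc
            have hi : t ∉ Set.Ici (F x / M) := not_le.2 hc
            simp only [hW, if_pos hc', Set.indicator_of_notMem hi,
              Set.indicator_of_mem (Set.mem_Iio.2 hc)]
            rw [← ENNReal.ofReal_mul (by positivity), mul_zero, add_zero,
              ← ENNReal.ofReal_mul (by positivity), Real.rpow_sub_one ht.ne' (p - 1)]
            congr 1
            field_simp
          · have hc' : ¬ M * t < F x := by rwa [lt_div_iff₀' hM] at hc
            have hi : t ∉ Set.Iio (F x / M) := hc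
            simp only [hW, if_neg hc', Set.indicator_of_notMem hi,
              Set.indicator_of_mem (Set.mem_Ici.2 (not_lt.1 hc))]
            rw [← ENNReal.ofReal_mul (by positivity), mul_zero, zero_add,
              ← ENNReal.ofReal_mul (by positivity), show p - 2 - 1 = p - 1 - (2 : ℕ) by
                push_cast; ring, Real.rpow_sub_natCast ht.ne']
            congr 1
            field_simp
      _ = ENNReal.ofReal (4 * M * F x) * ENNReal.ofReal ((F x / M) ^ (p - 1) / (p - 1)) +
          ENNReal.ofReal (4 * F x ^ 2) * ENNReal.ofReal ((F x / M) ^ (p - 2) / (-(p - 2))) := by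
          have m1 : ∀ r : ℝ, Measurable fun t : ℝ => ENNReal.ofReal (t ^ r) := fun r => by fun_prop
          rw [lintegral_add_left (((m1 _).indicator measurableSet_Iio).const_mul _),
            lintegral_const_mul _ ((m1 _).indicator measurableSet_Iio),
            lintegral_const_mul _ ((m1 _).indicator measurableSet_Ici),
            lintegral_Ioi_indicator_lt_rpow (by linarith) hs.le,
            lintegral_Ioi_indicator_ge_rpow (by linarith) hs]
      _ ≤ _ := by
          have hp1' : 0 < p - 1 := by linarith
          have hp2' : 0 < 2 - p := by linarith
          have hp2'' : 0 < -(p - 2) := by linarith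
          rw [← ENNReal.ofReal_mul (by positivity), ← ENNReal.ofReal_mul (by positivity),
            ← ENNReal.ofReal_add (by positivity) (by positivity),
            ← ENNReal.ofReal_mul (by positivity)]
          refine le_of_eq (congrArg _ ?_)
          -- With every power expressed through `(F x / M) ^ (p - 2)`, both terms become multiples
          -- of `M ^ (2 - p) * F x ^ p`.
          have e2 : F x ^ p = (F x / M) ^ (p - 2) * F x ^ 2 * M ^ (p - 2) := by
            rw [Real.div_rpow h0.le hM.le, div_mul_eq_mul_div,
              div_mul_cancel₀ _ (Real.rpow_pos_of_pos hM _).ne', ← Real.rpow_natCast,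
              ← Real.rpow_add h0]
            congr 1
            push_cast
            ring
          have e3 : (F x / M) ^ (p - 1) = (F x / M) ^ (p - 2) * (F x / M) := by
            rw [← Real.rpow_add_one hs.ne']
            congr 1
            ring
          have e4 : M ^ (2 - p) = (M ^ (p - 2))⁻¹ := by
            rw [← Real.rpow_neg hM.le]
            congr 1
            ring
          have hMp : 0 < M ^ (p - 2) := Real.rpow_pos_of_pos hM _
          rw [e2, e3, e4, neg_sub]
          field_simp
  have hp0 : 0 < p := by linarith
  calc ∫⁻ y, ENNReal.ofReal (g y ^ p) ∂ν
      = ENNReal.ofReal p *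
          ∫⁻ t in Set.Ioi (0 : ℝ), ν {y | t < g y} * ENNReal.ofReal (t ^ (p - 1)) :=
        lintegral_rpow_eq_lintegral_meas_lt_mul ν (.of_forall hg0) hg.aemeasurable hp0
    _ ≤ ENNReal.ofReal p *
          ∫⁻ t in Set.Ioi (0 : ℝ), (∫⁻ x, W t x * ENNReal.ofReal (t ^ (p - 1)) ∂μ) := by
        gcongr ENNReal.ofReal p * ?_
        refine setLIntegral_mono' measurableSet_Ioi fun t (ht : 0 < t) => ?_
        rw [lintegral_mul_const _ (hWm.of_uncurry_left)]
        gcongr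
        exact h t ht
    _ = ENNReal.ofReal p *
          ∫⁻ x, (∫⁻ t in Set.Ioi (0 : ℝ), W t x * ENNReal.ofReal (t ^ (p - 1))) ∂μ := by
        rw [lintegral_lintegral_swap]
        refine (hWm.mul ?_).aemeasurable
        fun_prop
    _ ≤ ENNReal.ofReal p * ∫⁻ x, ENNReal.ofReal ((4 / (p - 1) + 4 / (2 - p)) * M ^ (2 - p)) *
          ENNReal.ofReal (F x ^ p) ∂μ := by
        gcongr with x
        exact hinner x
    _ = _ := by
        rw [lintegral_const_mul _ (by fun_prop), ← mul_assoc, ← ENNReal.ofReal_mul hp0.le,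
          mul_assoc p]

/-- If `κ {t ≤ φ} ≤ M / t` for every `t > 0`, then `φ²κ` gives mass at most `2 M s` to
`{φ < s}`. -/
theorem setLIntegral_sq_lt_le {Y : Type*} [MeasurableSpace Y] {κ : Measure Y} {φ : Y → ℝ}
    (hφ : Measurable φ) (hφ0 : ∀ y, 0 ≤ φ y) {M : ℝ} (hM : 0 ≤ M)
    (h : ∀ t : ℝ, 0 < t → κ {y | t ≤ φ y} ≤ ENNReal.ofReal (M / t)) (s : ℝ) :
    ∫⁻ y in {y | φ y < s}, ENNReal.ofReal (φ y ^ 2) ∂κ ≤ ENNReal.ofReal (2 * M * s) := by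
  have key := lintegral_rpow_eq_lintegral_meas_le_mul (κ.restrict {y | φ y < s})
    (.of_forall hφ0) hφ.aemeasurable (p := 2) two_pos
  simp only [Real.rpow_two] at key
  rw [key]
  calc ENNReal.ofReal 2 * ∫⁻ t in Set.Ioi (0 : ℝ),
        (κ.restrict {y | φ y < s}) {y | t ≤ φ y} * ENNReal.ofReal (t ^ ((2 : ℝ) - 1))
      ≤ ENNReal.ofReal 2 * ∫⁻ t in Set.Ioi (0 : ℝ),
        (Set.Iio s).indicator (fun _ => ENNReal.ofReal M) t := by
        gcongr ENNReal.ofReal 2 * ?_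
        -- For `t < s` the layer-cake weight `t` cancels the `1 / t` of the hypothesis; for `t ≥ s`
        -- the level set is empty.
        refine setLIntegral_mono' measurableSet_Ioi fun t (ht : 0 < t) => ?_
        by_cases hts : t < s
        · rw [Set.indicator_of_mem (Set.mem_Iio.2 hts)]
          calc _ ≤ ENNReal.ofReal (M / t) * ENNReal.ofReal (t ^ ((2 : ℝ) - 1)) := by
                gcongr
                exact (Measure.restrict_le_self _).trans (h t ht)
            _ = _ := by
                rw [← ENNReal.ofReal_mul (by positivity)]
                norm_num
                field_simp
        · have : {y | t ≤ φ y} ∩ {y | φ y < s} = ∅ := by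
            ext y
            simp only [Set.mem_inter_iff, Set.mem_ofPred_eq, Set.mem_empty_iff_false, iff_false]
            rintro ⟨h1, h2⟩
            exact hts (h1.trans_lt h2)
          rw [Measure.restrict_apply (measurableSet_le measurable_const hφ), this]
          simp
    _ = _ := by
        rw [lintegral_indicator measurableSet_Iio, Measure.restrict_restrict measurableSet_Iio,
          Set.inter_comm, Set.Ioi_inter_Iio, setLIntegral_const, Real.volume_Ioo, sub_zero,
          ← ENNReal.ofReal_mul hM, ← ENNReal.ofReal_mul zero_le_two, mul_assoc]

/-! ### Paley's inequality for a bounded orthonormal system. -/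

section Paley

variable {X : Type*} [MeasurableSpace X] {μ : Measure X}

theorem integrable_mul_conj_of_memLp_two {f : X → ℂ} (hf : MemLp f 2 μ) (v : Lp ℂ 2 μ) :
    Integrable (fun x => f x * conj (v x)) μ :=
  hf.integrable_mul (Lp.memLp v).star

theorem integrable_mul_conj_of_bound {f : X → ℂ} (hf : Integrable f μ) (v : Lp ℂ 2 μ) {b : ℝ}
    (hb : ∀ᵐ x ∂μ, ‖v x‖ ≤ b) : Integrable (fun x => f x * conj (v x)) μ :=
  hf.mul_bdd (Lp.aestronglyMeasurable v).star (by simpa using hb)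

/-- **Bessel's inequality** in `L²(μ)`, with the coefficients written as integrals. -/
theorem tsum_enorm_integral_mul_conj_sq_le {ι : Type*} {u : ι → Lp ℂ 2 μ} (hu : Orthonormal ℂ u)
    {f : X → ℂ} (hf : MemLp f 2 μ) :
    ∑' j, ‖∫ x, f x * conj (u j x) ∂μ‖ₑ ^ 2 ≤ ∫⁻ x, ‖f x‖ₑ ^ 2 ∂μ := by
  have hcoef : ∀ j, ∫ x, f x * conj (u j x) ∂μ = inner ℂ (u j) hf.toLp := by
    intro j
    rw [L2.inner_def]
    refine integral_congr_ae ?_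
    filter_upwards [hf.coeFn_toLp] with x hx
    rw [hx, RCLike.inner_apply]
  have hnorm : ∫⁻ x, ‖f x‖ₑ ^ 2 ∂μ = ‖hf.toLp‖ₑ ^ 2 := by
    rw [Lp.enorm_toLp, eLpNorm_eq_lintegral_rpow_enorm_toReal two_ne_zero ENNReal.ofNat_ne_top,
      ← ENNReal.rpow_natCast, ← ENNReal.rpow_mul]
    simp
  rw [hnorm]
  simp_rw [hcoef]
  refine ENNReal.summable.tsum_le_of_sum_le fun s => ?_
  have h := hu.sum_inner_products_le (s := s) hf.toLp
  simp_rw [← ofReal_norm, ← ENNReal.ofReal_pow (norm_nonneg _)]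
  rw [← ENNReal.ofReal_sum_of_nonneg fun _ _ => by positivity]
  exact ENNReal.ofReal_le_ofReal h

theorem norm_integral_mul_conj_le {f : X → ℂ} (hf : Integrable f μ) (v : Lp ℂ 2 μ) {b : ℝ}
    (hb : ∀ᵐ x ∂μ, ‖v x‖ ≤ b) : ‖∫ x, f x * conj (v x) ∂μ‖ ≤ b * ∫ x, ‖f x‖ ∂μ := by
  rw [← integral_const_mul]
  refine norm_integral_le_of_norm_le (hf.norm.const_mul b) ?_
  filter_upwards [hb] with x hx
  rw [norm_mul, RCLike.norm_conj, mul_comm]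
  gcongr

/-- Truncating an `L^p` function from below at a positive height gives an integrable function. -/
theorem integrable_indicator_lt_norm {p a : ℝ} (hp : 1 ≤ p) (ha : 0 < a) {f : X → ℂ}
    (hf : StronglyMeasurable f) (hfp : Integrable (fun x => ‖f x‖ ^ p) μ) :
    Integrable ({x | a < ‖f x‖}.indicator f) μ := by
  have hm : MeasurableSet {x | a < ‖f x‖} := measurableSet_lt measurable_const hf.norm.measurable
  refine (hfp.const_mul (a ^ (1 - p))).mono' (hf.indicator hm).aestronglyMeasurable
    (.of_forall fun x => ?_)
  by_cases hx : a < ‖f x‖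
  · rw [Set.indicator_of_mem (show x ∈ {x | a < ‖f x‖} from hx)]
    have h0 := ha.trans hx
    calc ‖f x‖ = ‖f x‖ ^ (1 - p) * ‖f x‖ ^ p := by
          rw [← Real.rpow_add h0, sub_add_cancel, Real.rpow_one]
      _ ≤ a ^ (1 - p) * ‖f x‖ ^ p := by
          refine mul_le_mul_of_nonneg_right ?_ (by positivity)
          exact Real.rpow_le_rpow_of_nonpos ha hx.le (by linarith)
  · rw [Set.indicator_of_notMem (show x ∉ {x | a < ‖f x‖} from hx)]
    simp only [norm_zero]
    positivity

/-- Truncating an `L^p` function from above gives a square integrable function when `p ≤ 2`. -/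
theorem memLp_two_indicator_norm_le {p a : ℝ} (hp : p ≤ 2) (ha : 0 < a) {f : X → ℂ}
    (hf : StronglyMeasurable f) (hfp : Integrable (fun x => ‖f x‖ ^ p) μ) :
    MemLp ({x | a < ‖f x‖}ᶜ.indicator f) 2 μ := by
  have hm : MeasurableSet {x | a < ‖f x‖} := measurableSet_lt measurable_const hf.norm.measurable
  have hfm := hf.indicator hm.compl
  rw [memLp_two_iff_integrable_sq_norm hfm.aestronglyMeasurable]
  refine (hfp.const_mul (a ^ (2 - p))).mono' (hfm.norm.pow 2).aestronglyMeasurable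
    (.of_forall fun x => ?_)
  by_cases hx : a < ‖f x‖
  · rw [Set.indicator_of_notMem (show x ∉ {x | a < ‖f x‖}ᶜ from not_not.2 hx)]
    simp only [norm_zero, ne_eq, OfNat.ofNat_ne_zero, not_false_eq_true, zero_pow]
    positivity
  · rw [Set.indicator_of_mem (show x ∈ {x | a < ‖f x‖}ᶜ from hx), norm_pow, norm_norm]
    rcases (norm_nonneg (f x)).eq_or_lt with h0 | h0
    · rw [← h0]
      simp only [ne_eq, OfNat.ofNat_ne_zero, not_false_eq_true, zero_pow]
      positivity
    calc ‖f x‖ ^ 2 = ‖f x‖ ^ (2 - p) * ‖f x‖ ^ p := by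
          rw [← Real.rpow_add h0, sub_add_cancel, Real.rpow_two]
      _ ≤ a ^ (2 - p) * ‖f x‖ ^ p := by
          refine mul_le_mul_of_nonneg_right ?_ (by positivity)
          exact Real.rpow_le_rpow h0.le (not_lt.1 hx) (by linarith)

/-- Cut `f` at height `1`: the large part is integrable and pairs with the bounded `v`, the small
part is in `L²` and pairs with `v` in `L²`. -/
theorem integrable_mul_conj_of_memLp {p : ℝ} (hp1 : 1 ≤ p) (hp2 : p ≤ 2) {f : X → ℂ}
    (hf : StronglyMeasurable f) (hfp : Integrable (fun x => ‖f x‖ ^ p) μ) (v : Lp ℂ 2 μ) {b : ℝ}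
    (hb : ∀ᵐ x ∂μ, ‖v x‖ ≤ b) : Integrable (fun x => f x * conj (v x)) μ := by
  have h1 := integrable_mul_conj_of_bound
    (integrable_indicator_lt_norm hp1 one_pos hf hfp) v hb
  have h2 := integrable_mul_conj_of_memLp_two
    (memLp_two_indicator_norm_le hp2 one_pos hf hfp) v
  refine (h1.add h2).congr (.of_forall fun x => ?_)
  rw [Pi.add_apply, ← add_mul, Set.indicator_self_add_compl_apply]

/-- The distribution function of the normalized coefficients `|f̂(j)| / (b_j φ_j)` with respect to
the weights `(b_j φ_j)²`, in terms of a truncation of `f` at height `M t`. -/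
theorem distribution_coefficients_le {p M : ℝ} (hp1 : 1 ≤ p) (hp2 : p ≤ 2) (hM : 0 < M)
    {u : ℕ → Lp ℂ 2 μ} (hu : Orthonormal ℂ u) {b φ : ℕ → ℝ} (hb0 : ∀ j, 0 < b j)
    (hb : ∀ j, ∀ᵐ x ∂μ, ‖u j x‖ ≤ b j) (hφ0 : ∀ j, 0 < φ j)
    (hφ : ∀ t : ℝ, 0 < t → (Measure.count.withDensity fun j => ENNReal.ofReal (b j ^ 2))
      {j | t ≤ φ j} ≤ ENNReal.ofReal (M / t))
    {f : X → ℂ} (hf : StronglyMeasurable f) (hfp : Integrable (fun x => ‖f x‖ ^ p) μ)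
    {t : ℝ} (ht : 0 < t) :
    (Measure.count.withDensity fun j => ENNReal.ofReal ((b j * φ j) ^ 2))
      {j | t < ‖∫ x, f x * conj (u j x) ∂μ‖ / (b j * φ j)} ≤
    ∫⁻ x, (if M * t < ‖f x‖ then ENNReal.ofReal (4 * M / t * ‖f x‖)
        else ENNReal.ofReal (4 / t ^ 2 * ‖f x‖ ^ 2)) ∂μ := by
  set ν : Measure ℕ := Measure.count.withDensity fun j => ENNReal.ofReal ((b j * φ j) ^ 2) with hν
  have ha : 0 < M * t := by positivity
  have hm : MeasurableSet {x | M * t < ‖f x‖} :=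
    measurableSet_lt measurable_const hf.norm.measurable
  have hI1 := integrable_indicator_lt_norm hp1 ha hf hfp
  have hI2 := memLp_two_indicator_norm_le hp2 ha hf hfp
  set f1 := {x | M * t < ‖f x‖}.indicator f with hf1
  set f2 := {x | M * t < ‖f x‖}ᶜ.indicator f with hf2
  have hsplit : ∀ j, ∫ x, f x * conj (u j x) ∂μ =
      ∫ x, f1 x * conj (u j x) ∂μ + ∫ x, f2 x * conj (u j x) ∂μ := by
    intro j
    rw [← integral_add (integrable_mul_conj_of_bound hI1 _ (hb j))
      (integrable_mul_conj_of_memLp_two hI2 _)]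
    congr with x
    rw [← add_mul, hf1, hf2, Set.indicator_self_add_compl_apply]
  have hN : 0 ≤ ∫ x, ‖f1 x‖ ∂μ := integral_nonneg fun x => norm_nonneg _
  set N := ∫ x, ‖f1 x‖ ∂μ with hNdef
  -- One of the two parts must contribute more than half of `t`. For `f1` this forces `t / 2 * φ j <
  -- N`, since its coefficient is at most `b j * N`.
  have hsub : {j | t < ‖∫ x, f x * conj (u j x) ∂μ‖ / (b j * φ j)} ⊆
      {j | φ j < 2 / t * N} ∪ {j | t / 2 < ‖∫ x, f2 x * conj (u j x) ∂μ‖ / (b j * φ j)} := by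
    intro j hj
    by_contra hcon
    simp only [Set.mem_union, Set.mem_ofPred_eq, not_or, not_lt] at hcon hj
    have hbφ : 0 < b j * φ j := mul_pos (hb0 j) (hφ0 j)
    rw [lt_div_iff₀ hbφ, hsplit] at hj
    rw [div_le_iff₀ hbφ] at hcon
    have h1 := norm_integral_mul_conj_le hI1 _ (hb j)
    have h2 : N ≤ t / 2 * φ j := by
      have := hcon.1
      rw [div_mul_eq_mul_div, div_le_iff₀ ht] at this
      linarith
    have h3 : b j * N ≤ b j * (t / 2 * φ j) := mul_le_mul_of_nonneg_left h2 (hb0 j).le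
    have h4 := norm_add_le (∫ x, f1 x * conj (u j x) ∂μ) (∫ x, f2 x * conj (u j x) ∂μ)
    linarith [hcon.2]
  have hlow : ν {j | φ j < 2 / t * N} ≤
      ∫⁻ x in {x | M * t < ‖f x‖}, ENNReal.ofReal (4 * M / t * ‖f x‖) ∂μ := by
    -- Taking `s = 2 * N / t` gives mass at most `2 * M * s = 4 * M * N / t`.
    have h1 := setLIntegral_sq_lt_le (κ := Measure.count.withDensity
      fun j => ENNReal.ofReal (b j ^ 2)) (φ := φ) (by fun_prop) (fun j => (hφ0 j).le) hM.le hφ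
      (2 / t * N)
    rw [setLIntegral_withDensity_eq_setLIntegral_mul _ (by fun_prop) (by fun_prop)
      (MeasurableSet.of_discrete)] at h1
    have h2 : ν {j | φ j < 2 / t * N} = ∫⁻ j in {j | φ j < 2 / t * N},
        ((fun j => ENNReal.ofReal (b j ^ 2)) * fun j => ENNReal.ofReal (φ j ^ 2)) j
          ∂Measure.count := by
      rw [hν, withDensity_apply _ MeasurableSet.of_discrete]
      congr with j
      rw [Pi.mul_apply, ← ENNReal.ofReal_mul (sq_nonneg _), mul_pow]
    rw [h2]
    refine h1.trans_eq ?_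
    have h3 : N = ∫ x in {x | M * t < ‖f x‖}, ‖f x‖ ∂μ := by
      rw [hNdef, ← integral_indicator hm]
      congr with x
      rw [hf1, norm_indicator_eq_indicator_norm]
    have h4 : IntegrableOn f {x | M * t < ‖f x‖} μ := (integrable_indicator_iff hm).1 hI1
    rw [h3, ← ofReal_integral_eq_lintegral_ofReal (h4.norm.const_mul _)
      (.of_forall fun x => by positivity), integral_const_mul]
    congr 1
    ring
  have hhigh : ν {j | t / 2 < ‖∫ x, f2 x * conj (u j x) ∂μ‖ / (b j * φ j)} ≤
      ∫⁻ x in {x | M * t < ‖f x‖}ᶜ, ENNReal.ofReal (4 / t ^ 2 * ‖f x‖ ^ 2) ∂μ := by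
    rw [hν, withDensity_apply _ MeasurableSet.of_discrete,
      ← lintegral_indicator MeasurableSet.of_discrete, lintegral_count]
    -- Chebyshev at height `t / 2`: the weight `(b j * φ j) ^ 2` cancels the normalization, leaving
    -- the plain `ℓ²` sum for Bessel.
    calc _ ≤ ∑' j, ENNReal.ofReal (4 / t ^ 2) * ‖∫ x, f2 x * conj (u j x) ∂μ‖ₑ ^ 2 := by
          refine ENNReal.tsum_le_tsum (Set.indicator_le fun j hj => ?_)
          have hbφ : 0 < b j * φ j := mul_pos (hb0 j) (hφ0 j)
          rw [Set.mem_ofPred_eq, lt_div_iff₀ hbφ] at hj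
          rw [← ofReal_norm, ← ENNReal.ofReal_pow (norm_nonneg _),
            ← ENNReal.ofReal_mul (by positivity)]
          refine ENNReal.ofReal_le_ofReal ?_
          calc (b j * φ j) ^ 2 = 4 / t ^ 2 * (t / 2 * (b j * φ j)) ^ 2 := by
                field_simp
                norm_num
            _ ≤ _ := by gcongr
      _ ≤ ENNReal.ofReal (4 / t ^ 2) * ∫⁻ x, ‖f2 x‖ₑ ^ 2 ∂μ := by
          rw [ENNReal.tsum_mul_left]
          gcongr
          exact tsum_enorm_integral_mul_conj_sq_le hu hI2
      _ = ∫⁻ x in {x | M * t < ‖f x‖}ᶜ, ENNReal.ofReal (4 / t ^ 2 * ‖f x‖ ^ 2) ∂μ := by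
          rw [← lintegral_const_mul' _ _ ENNReal.ofReal_ne_top, ← lintegral_indicator hm.compl]
          congr with x
          by_cases hx : x ∈ {x | M * t < ‖f x‖}ᶜ
          · rw [Set.indicator_of_mem hx, hf2, Set.indicator_of_mem hx, ← ofReal_norm,
              ← ENNReal.ofReal_pow (norm_nonneg _), ← ENNReal.ofReal_mul (by positivity)]
          · rw [Set.indicator_of_notMem hx, hf2, Set.indicator_of_notMem hx]
            simp
  calc _ ≤ _ := measure_mono hsub
    _ ≤ _ := measure_union_le _ _
    _ ≤ _ := add_le_add hlow hhigh
    _ = _ := by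
        rw [← lintegral_add_compl (fun x => ite (M * t < ‖f x‖) _ _) hm]
        exact congrArg₂ _ (setLIntegral_congr_fun hm fun x hx => (if_pos hx).symm)
          (setLIntegral_congr_fun hm.compl fun x hx => (if_neg hx).symm)

/-- **Paley's inequality** for a bounded orthonormal system. -/
theorem tsum_coefficients_rpow_le [SFinite μ] {p M : ℝ} (hp1 : 1 < p) (hp2 : p < 2) (hM : 0 < M)
    {u : ℕ → Lp ℂ 2 μ} (hu : Orthonormal ℂ u) {b φ : ℕ → ℝ} (hb0 : ∀ j, 0 < b j)
    (hb : ∀ j, ∀ᵐ x ∂μ, ‖u j x‖ ≤ b j) (hφ0 : ∀ j, 0 < φ j)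
    (hφ : ∀ t : ℝ, 0 < t → (Measure.count.withDensity fun j => ENNReal.ofReal (b j ^ 2))
      {j | t ≤ φ j} ≤ ENNReal.ofReal (M / t))
    {f : X → ℂ} (hf : StronglyMeasurable f) (hfp : Integrable (fun x => ‖f x‖ ^ p) μ) :
    ∑' j, ENNReal.ofReal (‖∫ x, f x * conj (u j x) ∂μ‖ ^ p * b j ^ (2 - p) * φ j ^ (2 - p)) ≤
      ENNReal.ofReal (p * (4 / (p - 1) + 4 / (2 - p)) * M ^ (2 - p)) *
        ∫⁻ x, ENNReal.ofReal (‖f x‖ ^ p) ∂μ := by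
  have hbφ : ∀ j, 0 < b j * φ j := fun j => mul_pos (hb0 j) (hφ0 j)
  have key := lintegral_rpow_le_of_distribution_le hp1 hp2 hM hf.norm.measurable
    (fun x => norm_nonneg _) (g := fun j => ‖∫ x, f x * conj (u j x) ∂μ‖ / (b j * φ j))
    (by fun_prop) (fun j => div_nonneg (norm_nonneg _) (hbφ j).le)
    fun t ht => distribution_coefficients_le hp1.le hp2.le hM hu hb0 hb hφ0 hφ hf hfp ht
  refine le_trans (le_of_eq ?_) key
  rw [lintegral_withDensity_eq_lintegral_mul _ (by fun_prop) (by fun_prop), lintegral_count]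
  congr with j
  rw [Pi.mul_apply, ← ENNReal.ofReal_mul (sq_nonneg _)]
  congr 1
  rw [Real.div_rpow (norm_nonneg _) (hbφ j).le, mul_assoc,
    ← Real.mul_rpow (hb0 j).le (hφ0 j).le, Real.rpow_sub (hbφ j), Real.rpow_two]
  ring

end Paley

/-! ### Translation to the sup norms and the Paley constant in `[0, ∞]`. -/

section Eigenbasis

variable {n : ℕ} {u : HilbertBasis ℕ ℂ (Lp ℂ 2 (volume : Measure (EuclideanSpace ℝ (Fin n))))}
  {φ : ℕ → ℝ}

/-- Test the supremum at `t = φ j` and keep only the term `j`. -/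
theorem ofReal_mul_supNorm_sq_le (hφ0 : ∀ j, 0 < φ j) (j : ℕ) :
    ENNReal.ofReal (φ j) * supNorm u j ^ 2 ≤ paleyConst u φ :=
  calc _ ≤ ENNReal.ofReal (φ j) * ∑' i : {i : ℕ // φ j ≤ φ i}, supNorm u i ^ 2 := by
        gcongr
        exact ENNReal.le_tsum (f := fun i : {i : ℕ // φ j ≤ φ i} => supNorm u i ^ 2) ⟨j, le_rfl⟩
    _ ≤ _ := le_iSup₂ (f := fun (t : ℝ) (_ : 0 < t) =>
        ENNReal.ofReal t * ∑' j : {j : ℕ // t ≤ φ j}, supNorm u j ^ 2) (φ j) (hφ0 j)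

theorem supNorm_ne_zero (j : ℕ) : supNorm u j ≠ 0 := by
  intro h
  have hz : u j = 0 := by
    rw [supNorm, eLpNorm_eq_zero_iff (Lp.aestronglyMeasurable _) ENNReal.top_ne_zero] at h
    exact (Lp.eq_zero_iff_ae_eq_zero).2 h
  exact u.orthonormal.ne_zero j hz

/-- Finiteness of the Paley constant forces every basis function to be bounded. -/
theorem supNorm_ne_top (hφ0 : ∀ j, 0 < φ j) (hM : paleyConst u φ < ∞) (j : ℕ) :
    supNorm u j ≠ ∞ := by
  intro h
  have := ofReal_mul_supNorm_sq_le (u := u) hφ0 j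
  rw [h, ENNReal.top_pow two_ne_zero, ENNReal.mul_top (by simpa using hφ0 j), top_le_iff] at this
  exact hM.ne this

theorem paleyConst_ne_zero (hφ0 : ∀ j, 0 < φ j) : paleyConst u φ ≠ 0 := by
  intro h
  have := ofReal_mul_supNorm_sq_le (u := u) hφ0 0
  rw [h, nonpos_iff_eq_zero] at this
  exact mul_ne_zero (by simpa using hφ0 0) (pow_ne_zero 2 (supNorm_ne_zero 0)) this

theorem ae_norm_le_toReal_supNorm {j : ℕ} (h : supNorm u j ≠ ∞) :
    ∀ᵐ x, ‖u j x‖ ≤ (supNorm u j).toReal := by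
  have := ae_le_eLpNormEssSup (f := u j) (μ := volume)
  filter_upwards [this] with x hx
  rw [← ENNReal.ofReal_le_iff_le_toReal h, ofReal_norm]
  simpa [supNorm] using hx

theorem withDensity_supNorm_sq_le (hφ0 : ∀ j, 0 < φ j) (hM : paleyConst u φ < ∞) {t : ℝ}
    (ht : 0 < t) :
    (Measure.count.withDensity fun j => ENNReal.ofReal ((supNorm u j).toReal ^ 2)) {j | t ≤ φ j} ≤
      ENNReal.ofReal ((paleyConst u φ).toReal / t) := by
  have hb : ∀ j, ENNReal.ofReal ((supNorm u j).toReal ^ 2) = supNorm u j ^ 2 := fun j => by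
    rw [ENNReal.ofReal_pow ENNReal.toReal_nonneg, ENNReal.ofReal_toReal (supNorm_ne_top hφ0 hM j)]
  simp_rw [hb]
  rw [withDensity_apply _ MeasurableSet.of_discrete,
    ← lintegral_indicator MeasurableSet.of_discrete, lintegral_count, ← tsum_subtype,
    ENNReal.ofReal_div_of_pos ht, ENNReal.ofReal_toReal hM.ne,
    ENNReal.le_div_iff_mul_le (by simp [ht]) (by simp), mul_comm]
  exact le_iSup₂ (f := fun (t : ℝ) (_ : 0 < t) =>
        ENNReal.ofReal t * ∑' j : {j : ℕ // t ≤ φ j}, supNorm u j ^ 2) t ht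

theorem integrable_norm_rpow_of_memLp {X : Type*} [MeasurableSpace X] {μ : Measure X} {p : ℝ}
    (hp : 0 < p) {f : X → ℂ} (hf : MemLp f (ENNReal.ofReal p) μ) :
    Integrable (fun x => ‖f x‖ ^ p) μ := by
  simpa [ENNReal.toReal_ofReal hp.le] using
    hf.integrable_norm_rpow (by simpa using hp) ENNReal.ofReal_ne_top

theorem eLpNorm_ofReal_eq {X : Type*} [MeasurableSpace X] {μ : Measure X} {p : ℝ}
    (hp : 0 < p) (f : X → ℂ) :
    eLpNorm f (ENNReal.ofReal p) μ = (∫⁻ x, ENNReal.ofReal (‖f x‖ ^ p) ∂μ) ^ (1 / p) := by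
  rw [eLpNorm_eq_lintegral_rpow_enorm_toReal (by simpa using hp) ENNReal.ofReal_ne_top,
    ENNReal.toReal_ofReal hp.le]
  congr with x
  rw [← ENNReal.ofReal_rpow_of_nonneg (norm_nonneg _) hp.le, ofReal_norm]

theorem paley_of_stronglyMeasurable {p : ℝ} (hp1 : 1 < p) (hp2 : p < 2) (hφ0 : ∀ j, 0 < φ j)
    (hM : paleyConst u φ < ∞) {f : EuclideanSpace ℝ (Fin n) → ℂ} (hf : StronglyMeasurable f)
    (hfp : MemLp f (ENNReal.ofReal p) volume) :
    (∑' j, ‖fourier u f j‖ₑ ^ p * supNorm u j ^ (2 - p) *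
        ENNReal.ofReal (φ j) ^ (2 - p)) ^ (1 / p) ≤
      ENNReal.ofReal (p * (4 / (p - 1) + 4 / (2 - p))) ^ (1 / p) *
        paleyConst u φ ^ ((2 - p) / p) * eLpNorm f (ENNReal.ofReal p) volume := by
  have hp0 : 0 < p := by linarith
  have hp1' : 0 < p - 1 := by linarith
  have hp2' : 0 < 2 - p := by linarith
  have htop := supNorm_ne_top (u := u) hφ0 hM
  have hMpos := ENNReal.toReal_pos (paleyConst_ne_zero hφ0) hM.ne
  have key := tsum_coefficients_rpow_le hp1 hp2 hMpos u.orthonormal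
    (fun j => ENNReal.toReal_pos (supNorm_ne_zero j) (htop j))
    (fun j => ae_norm_le_toReal_supNorm (htop j)) hφ0
    (fun t ht => withDensity_supNorm_sq_le hφ0 hM ht) hf (integrable_norm_rpow_of_memLp hp0 hfp)
  have hterm : ∀ j, ‖fourier u f j‖ₑ ^ p * supNorm u j ^ (2 - p) * ENNReal.ofReal (φ j) ^ (2 - p) =
      ENNReal.ofReal (‖∫ x, f x * conj (u j x)‖ ^ p * (supNorm u j).toReal ^ (2 - p) *
        φ j ^ (2 - p)) := by
    intro j
    have := (hφ0 j).le
    rw [ENNReal.ofReal_mul (by positivity), ENNReal.ofReal_mul (by positivity),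
      ← ENNReal.ofReal_rpow_of_nonneg (norm_nonneg _) hp0.le,
      ← ENNReal.ofReal_rpow_of_nonneg ENNReal.toReal_nonneg hp2'.le,
      ← ENNReal.ofReal_rpow_of_nonneg this hp2'.le, ENNReal.ofReal_toReal (htop j), ofReal_norm,
      fourier]
  simp_rw [hterm]
  refine (ENNReal.rpow_le_rpow key (by positivity)).trans_eq ?_
  rw [ENNReal.mul_rpow_of_nonneg _ _ (by positivity), ENNReal.ofReal_mul (by positivity),
    ENNReal.mul_rpow_of_nonneg _ _ (by positivity), ← eLpNorm_ofReal_eq hp0,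
    ← ENNReal.ofReal_rpow_of_nonneg ENNReal.toReal_nonneg hp2'.le, ENNReal.ofReal_toReal hM.ne,
    ← ENNReal.rpow_mul, mul_one_div]

theorem fourier_congr_ae {f g : EuclideanSpace ℝ (Fin n) → ℂ} (h : f =ᵐ[volume] g) (j : ℕ) :
    fourier u f j = fourier u g j :=
  integral_congr_ae (h.mono fun x hx => by simp only [hx])

theorem tsum_enorm_fourier_sq_le {f : EuclideanSpace ℝ (Fin n) → ℂ} (hf : MemLp f 2 volume) :
    (∑' j, ‖fourier u f j‖ₑ ^ (2 : ℝ)) ^ (1 / 2 : ℝ) ≤ eLpNorm f 2 volume := by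
  rw [eLpNorm_eq_lintegral_rpow_enorm_toReal two_ne_zero ENNReal.ofNat_ne_top]
  simp only [ENNReal.toReal_ofNat, ENNReal.rpow_two]
  gcongr
  exact tsum_enorm_integral_mul_conj_sq_le u.orthonormal hf

end Eigenbasis

end Anharmonic

/-! ### The main theorem. -/

theorem theorem4p1 (p : ℝ) (hp1 : 1 < p) (hp2 : p ≤ 2) :
    ∃ C : ℝ≥0, ∀ (n k l : ℕ), 1 ≤ n → 1 ≤ k → 1 ≤ l →
      ∀ (lam : ℕ → ℝ)
        (u : HilbertBasis ℕ ℂ (Lp ℂ 2 (volume : Measure (EuclideanSpace ℝ (Fin n))))),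
        Anharmonic.IsEigenbasis n k l lam u →
      ∀ φ : ℕ → ℝ, (∀ j, 0 < φ j) → Anharmonic.paleyConst u φ < ∞ →
      ∀ f : EuclideanSpace ℝ (Fin n) → ℂ, MemLp f (ENNReal.ofReal p) volume →
        (∀ j, Integrable (fun x => f x * conj (u j x)) volume) ∧
        (∑' j, ‖Anharmonic.fourier u f j‖ₑ ^ p * Anharmonic.supNorm u j ^ (2 - p) *
            ENNReal.ofReal (φ j) ^ (2 - p)) ^ (1 / p) ≤
          (C : ℝ≥0∞) * Anharmonic.paleyConst u φ ^ ((2 - p) / p) *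
            eLpNorm f (ENNReal.ofReal p) volume := by
  have hp0 : 0 < p := by linarith
  have hint : ∀ (n : ℕ)
      (u : HilbertBasis ℕ ℂ (Lp ℂ 2 (volume : Measure (EuclideanSpace ℝ (Fin n)))))
      (φ : ℕ → ℝ), (∀ j, 0 < φ j) → Anharmonic.paleyConst u φ < ∞ →
      ∀ f : EuclideanSpace ℝ (Fin n) → ℂ, MemLp f (ENNReal.ofReal p) volume →
        ∀ j, Integrable (fun x => f x * conj (u j x)) volume := by
    intro n u φ hφ0 hM f hf j
    -- The truncation lemmas need a strongly measurable `f`; changing it on a null set alters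
    -- neither coefficients nor norms.
    have hg := (memLp_congr_ae hf.1.ae_eq_mk).1 hf
    refine (Anharmonic.integrable_mul_conj_of_memLp hp1.le hp2 hf.1.stronglyMeasurable_mk
      (Anharmonic.integrable_norm_rpow_of_memLp hp0 hg) (u j)
      (Anharmonic.ae_norm_le_toReal_supNorm (Anharmonic.supNorm_ne_top hφ0 hM j))).congr ?_
    filter_upwards [hf.1.ae_eq_mk] with x hx
    rw [hx]
  rcases hp2.eq_or_lt with rfl | hp2
  -- At `p = 2` the weights have exponent `0`, and Bessel gives the constant `1`.
  · refine ⟨1, fun n k l _ _ _ lam u _ φ hφ0 hM f hf => ⟨hint n u φ hφ0 hM f hf, ?_⟩⟩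
    rw [ENNReal.ofReal_ofNat] at hf ⊢
    simpa using Anharmonic.tsum_enorm_fourier_sq_le (u := u) hf
  · refine ⟨(p * (4 / (p - 1) + 4 / (2 - p))).toNNReal ^ (1 / p),
      fun n k l _ _ _ lam u _ φ hφ0 hM f hf => ⟨hint n u φ hφ0 hM f hf, ?_⟩⟩
    have hg := (memLp_congr_ae hf.1.ae_eq_mk).1 hf
    have key := Anharmonic.paley_of_stronglyMeasurable (u := u) hp1 hp2 hφ0 hM
      hf.1.stronglyMeasurable_mk hg
    simp_rw [← Anharmonic.fourier_congr_ae hf.1.ae_eq_mk,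
      ← eLpNorm_congr_ae hf.1.ae_eq_mk] at key
    rwa [ENNReal.coe_rpow_of_nonneg _ (by positivity)]
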